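/- Let $R=(|R|,\le,+,\cdot,0,1)$ be a resource semiring: a semiring with a partial order for which $+$ and $\cdot$ are monotone. **Doctrines.** A doctrine is a functor $P:\mathcal C^{op}\to\mathbf{Pos}$, where $\mathcal C$ (the base) has chosen finite products; write $P_f$ for $P(f)$. A 1-arrow $(F,f):P\to Q$ is a finite-product preserving functor $F$ between the bases with a natural transformation $f:P\to Q\circ F^{op}$; a 2-arrow $(F,f)\Rightarrow(G,g)$ is a natural transformation $\theta:F\Rightarrow G$ with $f_X(\alpha)\le Q_{\theta_X}(g_X(\alpha))$ for all $X$ and $\alpha\in P(X)$. A primary linear doctrine is a doctrine each of whose fibres is an ordered commutative monoid $(P(X),\ast,\kappa_X)$, preserved by all $P_f$. An $R$-graded doctrine is a primary linear doctrine $P$ with natural transformations $\lceil r\rceil:P\to P$ of posets ($r\in|R|$) such that $\kappa\le\lceil r\rceil\kappa$, $\ \lceil r\rceil\alpha\ast\lceil r\rceil\beta\le\lceil r\rceil(\alpha\ast\beta)$, $\ \lceil 0\rceil\alpha\le\kappa$, $\ \lceil r+s\rceil\alpha\le\lceil r\rceil\alpha\ast\lceil s\rceil\alpha$, $\ \lceil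 1\rceil\alpha\le\alpha$, $\ \lceil r\cdot s\rceil\alpha\le\lceil r\rceil\lceil s\rceil\alpha$, and $\lceil r\rceil\alpha\le\lceil s\rceil\alpha$ whenever $s\le r$. A 1-arrow of $R$-graded doctrines is a 1-arrow of doctrines preserving $\ast$, $\kappa$ and all $\lceil r\rceil$; 2-arrows are those of doctrines. An element $\alpha$ of a fibre is *intuitionistic* if $\alpha\le\lceil r\rceil\alpha$ for all $r$. **Lipschitz doctrines.** A distance on $A$ is $\rho\in P(A\times A)$ with $\kappa_A\le P_{\Delta_A}(\rho)$, $\rho\le P_{\langle\pi_2,\pi_1\rangle}(\rho)$ and $P_{\langle\pi_1,\pi_2\rangle}(\rho)\ast P_{\langle\pi_2,\pi_3\rangle}(\rho)\le P_{\langle\pi_1,\pi_3\rangle}(\rho)$. An $R$-Lipschitz doctrine is an $R$-graded doctrine with a distance $\delta_A$ on each object $A$ such that, for all $A,X$: for each $\alpha\in P(X\times A)$ there is $r\in|R|$ with $P_{\langle\pi_1,\pi_2\rangle}(\alpha)\ast\lceil r\rceil P_{\langle\pi_2,\pi_3\rangle}(\delta_A)\le P_{\langle\pi_1,\pi_3\rangle}(\alpha)$;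 $\ \delta_{A\times X}=P_{\langle\pi_1,\pi_3\rangle}(\delta_A)\ast P_{\langle\pi_2,\pi_4\rangle}(\delta_X)$; $\ \delta_{A\times X}\le P_{\langle\pi_1,\pi_3\rangle}(\delta_A)$ and $\delta_{A\times X}\le P_{\langle\pi_2,\pi_4\rangle}(\delta_X)$; $\ \delta_1=\kappa$. These are the objects of a 2-category $\mathbf{Lip}_R$, whose 1-arrows are the 1-arrows $(F,f)$ of $R$-graded doctrines with $f_{A\times A}(\delta_A)=\delta_{FA}$ (up to the canonical isomorphism $F(A\times A)\cong FA\times FA$) and whose 2-arrows are all 2-arrows of doctrines. **Elementary doctrines.** An $R$-graded doctrine is elementary if for each $A$ there is $\delta_A\in P(A\times A)$ with $\kappa_A\le P_{\Delta_A}(\delta_A)$ and $P_{\langle\pi_1,\pi_2\rangle}(\alpha)\ast P_{\langle\pi_2,\pi_3\rangle}(\delta_A)\le P_{\langle\pi_1,\pi_3\rangle}(\alpha)$ for all $X$ and $\alpha\in P(X\times A)$. Such $\delta_A$ is unique, and $E_{\mathrm{id}_X\times\Delta_A}(\alpha)=P_{\langle\pi_1,\pi_2\rangle}(\alpha)\ast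 P_{\langle\pi_2,\pi_3\rangle}(\delta_A)$ is left adjoint to $P_{\mathrm{id}_X\times\Delta_A}$. These are the objects of a 2-category $\mathbf{El}_R$, whose 1-arrows are the 1-arrows $(F,f)$ of $R$-graded doctrines with $E_{\mathrm{id}_{FX}\times\Delta_{FA}}\circ f_{X\times A}=f_{X\times A\times A}\circ E_{\mathrm{id}_X\times\Delta_A}$ for all $X,A$ (up to the canonical isomorphisms), and whose 2-arrows are all 2-arrows of doctrines. **The 2-functors.** An elementary $R$-graded doctrine is $R$-Lipschitz with distances the $\delta_A$; this gives the inclusion 2-functor $EL:\mathbf{El}_R\to\mathbf{Lip}_R$. The 2-functor $LE:\mathbf{Lip}_R\to\mathbf{El}_R$ sends an $R$-Lipschitz doctrine $P$ to its restriction to the full subcategory of the base on the objects $A$ with $\delta_A$ intuitionistic (which is closed under the chosen finite products, and on which $\delta$ gives the equality predicates), and restricts 1-arrows and 2-arrows accordingly. **Theorem.** The 2-functor $EL$ is 2-comonadic: 1. $LE$ is right 2-adjoint to $EL$, with counit at $P$ the inclusion of the restriction of $P$ into $P$ (the inclusion functor on the bases, identities on the fibres); 2. the comparison 2-functor from $\mathbf{El}_R$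 to the 2-category of (strict) coalgebras of the induced 2-comonad $EL\circ LE$ is an isomorphism of 2-categories, and this 2-comonad is KZ: the structure 1-arrow $c$ of each coalgebra is left adjoint to the counit $\varepsilon$, with the identity $1=\varepsilon\circ c$ as unit of the adjunction. -/

import Mathlib

universe w v u w₁ v₁ u₁ w₂ v₂ u₂ x

namespace TwoCat

open CategoryTheory Bicategory

/-- A strict 2-natural transformation between 2-functors of strict 2-categories. -/
structure TwoNatTrans {B : Type u₁} [Bicategory.{w₁, v₁} B] {C : Type u₂} [Bicategory.{w₂, v₂} C]
    (F G : StrictPseudofunctor B C) where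
  app (X : B) : F.obj X ⟶ G.obj X
  naturality {X Y : B} (f : X ⟶ Y) : F.map f ≫ app Y = app X ≫ G.map f
  naturality₂ {X Y : B} {f g : X ⟶ Y} (η : f ⟶ g) :
    F.map₂ η ▷ app Y ≫ eqToHom (naturality g) = eqToHom (naturality f) ≫ app X ◁ G.map₂ η

/-- A 2-adjunction `F ⊣ G`, with 2-natural unit and counit and strict triangle identities. -/
structure TwoAdjunction {B : Type u₁} [Bicategory.{w₁, v₁} B] {C : Type u₂}
    [Bicategory.{w₂, v₂} C] (F : StrictPseudofunctor B C) (G : StrictPseudofunctor C B) where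
  unit : TwoNatTrans (StrictPseudofunctor.id B) (F.comp G)
  counit : TwoNatTrans (G.comp F) (StrictPseudofunctor.id C)
  left_triangle (X : B) :
    F.map (unit.app X) ≫ counit.app (F.obj X) = 𝟙 (F.obj X)
  right_triangle (Y : C) :
    unit.app (G.obj Y) ≫ G.map (counit.app Y) = 𝟙 (G.obj Y)

/-- A (strict) 2-comonad on a strict 2-category. -/
structure TwoComonad (C : Type u) [Bicategory.{w, v} C] where
  fn : StrictPseudofunctor C C
  counit : TwoNatTrans fn (StrictPseudofunctor.id C)
  comult : TwoNatTrans fn (fn.comp fn)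
  comult_counit (X : C) :
    (comult.app X : fn.obj X ⟶ fn.obj (fn.obj X)) ≫
      (counit.app (fn.obj X) : fn.obj (fn.obj X) ⟶ fn.obj X) = 𝟙 (fn.obj X)
  comult_map_counit (X : C) :
    (comult.app X : fn.obj X ⟶ fn.obj (fn.obj X)) ≫
      fn.map (counit.app X : fn.obj X ⟶ X) = 𝟙 (fn.obj X)
  coassoc (X : C) :
    (comult.app X : fn.obj X ⟶ fn.obj (fn.obj X)) ≫
        fn.map (comult.app X : fn.obj X ⟶ fn.obj (fn.obj X)) =
      (comult.app X : fn.obj X ⟶ fn.obj (fn.obj X)) ≫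
        (comult.app (fn.obj X) : fn.obj (fn.obj X) ⟶ fn.obj (fn.obj (fn.obj X)))

section Adj

variable {B : Type u₁} [Bicategory.{w₁, v₁} B] {C : Type u₂} [Bicategory.{w₂, v₂} C]
    {F : StrictPseudofunctor B C} {G : StrictPseudofunctor C B}

theorem map₂_whiskerRight' (F : StrictPseudofunctor B C) {X Y Z : B} {f g : X ⟶ Y} (η : f ⟶ g)
    (h : Y ⟶ Z) : F.map₂ (η ▷ h) = eqToHom (F.map_comp f h) ≫ F.map₂ η ▷ F.map h ≫
      eqToHom (F.map_comp g h).symm := by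
  simp [F.map₂_whisker_right, F.mapComp_eq_eqToIso]

theorem map₂_whiskerLeft' (F : StrictPseudofunctor B C) {X Y Z : B} (h : X ⟶ Y) {f g : Y ⟶ Z}
    (η : f ⟶ g) : F.map₂ (h ◁ η) = eqToHom (F.map_comp h f) ≫ F.map h ◁ F.map₂ η ≫
      eqToHom (F.map_comp h g).symm := by
  simp [F.map₂_whisker_left, F.mapComp_eq_eqToIso]

theorem map₂_square (F : StrictPseudofunctor B C) {X X' Y Y' : B} {a b : X ⟶ Y} {u : X ⟶ X'}
    {v : Y ⟶ Y'} {a' b' : X' ⟶ Y'} {η : a ⟶ b} {η' : a' ⟶ b'} (ha : a ≫ v = u ≫ a')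
    (hb : b ≫ v = u ≫ b') (h : η ▷ v ≫ eqToHom hb = eqToHom ha ≫ u ◁ η') :
    F.map₂ η ▷ F.map v ≫ eqToHom ((F.map_comp b v).symm.trans
        ((congrArg F.map hb).trans (F.map_comp u b'))) =
      eqToHom ((F.map_comp a v).symm.trans ((congrArg F.map ha).trans (F.map_comp u a'))) ≫
        F.map u ◁ F.map₂ η' := by
  have h' := congrArg F.map₂ h
  simp only [F.map₂_comp, map₂_whiskerRight', map₂_whiskerLeft', PrelaxFunctor.map₂_eqToHom,
    Category.assoc, eqToHom_trans, eqToHom_trans_assoc] at h'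
  rw [← cancel_epi (eqToHom (F.map_comp a v)), ← cancel_mono (eqToHom (F.map_comp u b').symm)]
  simpa using h'

theorem square_symm {X Y : C} {a b a' b' : X ⟶ Y} {η : a ⟶ b} {η' : a' ⟶ b'} (ha : a = a')
    (hb : b = b') (h : η ≫ eqToHom hb = eqToHom ha ≫ η') :
    η' ≫ eqToHom hb.symm = eqToHom ha.symm ≫ η := by
  subst ha hb
  simpa using h.symm

/-- The 2-comonad `F ∘ G` induced by a 2-adjunction `F ⊣ G`. -/
def TwoAdjunction.comonad (adj : TwoAdjunction F G) : TwoComonad C where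
  fn := G.comp F
  counit := adj.counit
  comult :=
    { app := fun Y => F.map (adj.unit.app (G.obj Y))
      naturality := fun {X Y} f => by
        have h := congrArg F.map (adj.unit.naturality (G.map f))
        exact (F.map_comp _ _).symm.trans (h.trans (F.map_comp _ _))
      naturality₂ := fun {X Y f g} η => by
        have h := map₂_square F _ _ (adj.unit.naturality₂ (G.map₂ η))
        exact h }
  comult_counit := fun X => adj.left_triangle (G.obj X)
  comult_map_counit := fun X => by
    have h := congrArg F.map (adj.right_triangle X)
    exact (F.map_comp _ _).symm.trans (h.trans (F.map_id _))
  coassoc := fun X => by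
    have h := congrArg F.map (adj.unit.naturality (adj.unit.app (G.obj X)))
    exact (F.map_comp _ _).symm.trans (h.symm.trans (F.map_comp _ _))

end Adj

section Coalg

variable {C : Type u} [Bicategory.{w, v} C] [Bicategory.Strict C]

/-- A strict coalgebra of a 2-comonad. -/
structure Coalgebra (T : TwoComonad C) where
  obj : C
  str : obj ⟶ T.fn.obj obj
  counit : str ≫ T.counit.app obj = 𝟙 obj
  coassoc : str ≫ T.fn.map str = str ≫ T.comult.app obj

namespace Coalgebra

variable {T : TwoComonad C}

/-- A strict morphism of coalgebras. -/
@[ext]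
structure Hom (A B : Coalgebra T) where
  hom : A.obj ⟶ B.obj
  comm : A.str ≫ T.fn.map hom = hom ≫ B.str

/-- A 2-cell between coalgebra morphisms: a 2-cell of the ambient 2-category that is compatible
with the coalgebra structures. -/
@[ext]
structure Hom₂ {A B : Coalgebra T} (f g : Hom A B) where
  hom : f.hom ⟶ g.hom
  comm : A.str ◁ T.fn.map₂ hom ≫ eqToHom g.comm = eqToHom f.comm ≫ hom ▷ B.str

instance : CategoryStruct (Coalgebra T) where
  Hom A B := Hom A B
  id A := ⟨𝟙 A.obj, by rw [T.fn.map_id, Strict.comp_id, Strict.id_comp]⟩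
  comp {A B D} f g := ⟨f.hom ≫ g.hom, by
    rw [T.fn.map_comp, ← Strict.assoc, f.comm, Strict.assoc, g.comm, Strict.assoc]⟩

instance (A B : Coalgebra T) : Category (A ⟶ B) where
  Hom f g := Hom₂ f g
  id f := ⟨𝟙 f.hom, by simp⟩
  comp {f g h} a b := ⟨a.hom ≫ b.hom, by
    rw [T.fn.map₂_comp, whiskerLeft_comp, Category.assoc, b.comm, ← Category.assoc, a.comm,
      Category.assoc, comp_whiskerRight]⟩

@[simp]
theorem id_hom (A : Coalgebra T) : Hom.hom (𝟙 A) = 𝟙 A.obj := rfl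

@[simp]
theorem comp_hom {A B D : Coalgebra T} (f : A ⟶ B) (g : B ⟶ D) :
    Hom.hom (f ≫ g) = f.hom ≫ g.hom := rfl

@[simp]
theorem id_hom₂ {A B : Coalgebra T} (f : A ⟶ B) : Hom₂.hom (𝟙 f) = 𝟙 f.hom := rfl

@[simp]
theorem comp_hom₂ {A B : Coalgebra T} {f g h : A ⟶ B} (a : f ⟶ g) (b : g ⟶ h) :
    Hom₂.hom (a ≫ b) = a.hom ≫ b.hom := rfl

@[ext]
theorem hom_ext {A B : Coalgebra T} {f g : A ⟶ B} (h : f.hom = g.hom) : f = g := Hom.ext h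

@[ext]
theorem hom₂_ext {A B : Coalgebra T} {f g : A ⟶ B} {a b : f ⟶ g} (h : a.hom = b.hom) : a = b :=
  Hom₂.ext h

@[simp]
theorem eqToHom_hom {A B : Coalgebra T} {f g : A ⟶ B} (h : f = g) :
    (eqToHom h).hom = eqToHom (congrArg Hom.hom h) := by
  subst h; rfl

theorem whiskerLeft_comm {A B D : Coalgebra T} (f : A ⟶ B) {g h : B ⟶ D} (η : g ⟶ h) :
    A.str ◁ T.fn.map₂ (f.hom ◁ η.hom) ≫ eqToHom (f ≫ h).comm =
      eqToHom (f ≫ g).comm ≫ (f.hom ◁ η.hom) ▷ D.str := by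
  have h₁ : A.str ◁ T.fn.map f.hom ◁ T.fn.map₂ η.hom =
      eqToHom (by rw [← Strict.assoc, f.comm, Strict.assoc]) ≫
        f.hom ◁ B.str ◁ T.fn.map₂ η.hom ≫
          eqToHom (by rw [← Strict.assoc, ← f.comm, Strict.assoc]) := by
    have h := congr_whiskerLeft f.comm (T.fn.map₂ η.hom)
    simp only [Bicategory.comp_whiskerLeft, Strict.associator_eqToIso, eqToIso.hom, eqToIso.inv,
      Category.assoc] at h
    rw [← cancel_epi (eqToHom (Strict.assoc _ _ _)),
      ← cancel_mono (eqToHom (Strict.assoc _ _ _).symm)]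
    simpa using h
  have h₂ := congrArg (fun t => f.hom ◁ t) η.comm
  simp only [Bicategory.whiskerLeft_comp, Bicategory.whiskerLeft_eqToHom] at h₂
  rw [map₂_whiskerLeft']
  simp only [Bicategory.whiskerLeft_comp, Bicategory.whiskerLeft_eqToHom, h₁, Category.assoc,
    eqToHom_trans, eqToHom_trans_assoc, Bicategory.whisker_assoc, Strict.associator_eqToIso,
    eqToIso.hom, eqToIso.inv]
  rw [← cancel_mono (eqToHom (Strict.assoc f.hom h.hom D.str))]
  have h₃ := congrArg (fun t => eqToHom (by
    rw [T.fn.map_comp, ← Strict.assoc, f.comm, Strict.assoc] :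
      A.str ≫ T.fn.map (f.hom ≫ g.hom) = f.hom ≫ B.str ≫ T.fn.map g.hom) ≫ t) h₂
  simpa using h₃

theorem whiskerRight_comm {A B D : Coalgebra T} {f g : A ⟶ B} (η : f ⟶ g) (h : B ⟶ D) :
    A.str ◁ T.fn.map₂ (η.hom ▷ h.hom) ≫ eqToHom (g ≫ h).comm =
      eqToHom (f ≫ h).comm ≫ (η.hom ▷ h.hom) ▷ D.str := by
  have h₁ : η.hom ▷ B.str ▷ T.fn.map h.hom =
      eqToHom (by rw [Strict.assoc, h.comm, ← Strict.assoc]) ≫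
        η.hom ▷ h.hom ▷ D.str ≫
          eqToHom (by rw [Strict.assoc, ← h.comm, ← Strict.assoc]) := by
    have h := whiskerRight_congr h.comm η.hom
    simp only [Bicategory.whiskerRight_comp, Strict.associator_eqToIso, eqToIso.hom, eqToIso.inv,
      Category.assoc] at h
    rw [← cancel_epi (eqToHom (Strict.assoc _ _ _).symm),
      ← cancel_mono (eqToHom (Strict.assoc _ _ _))]
    simpa using h
  have h₂ := congrArg (fun t => t ▷ T.fn.map h.hom) η.comm
  simp only [Bicategory.comp_whiskerRight, Bicategory.eqToHom_whiskerRight, h₁,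
    Bicategory.whisker_assoc, Strict.associator_eqToIso, eqToIso.hom, eqToIso.inv,
    Category.assoc, eqToHom_trans, eqToHom_trans_assoc] at h₂
  rw [map₂_whiskerRight']
  simp only [Bicategory.whiskerLeft_comp, Bicategory.whiskerLeft_eqToHom, Category.assoc,
    eqToHom_trans]
  rw [← cancel_epi (eqToHom (by rw [T.fn.map_comp, ← Strict.assoc] :
      (A.str ≫ T.fn.map f.hom) ≫ T.fn.map h.hom = A.str ≫ T.fn.map (f.hom ≫ h.hom))),
    ← cancel_mono (eqToHom (by rw [Strict.assoc, ← h.comm, ← Strict.assoc] :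
      (g.hom ≫ h.hom) ≫ D.str = (g.hom ≫ B.str) ≫ T.fn.map h.hom))]
  simpa using h₂

/-- Left whiskering in the 2-category of coalgebras. -/
@[simps]
def whiskerL {A B D : Coalgebra T} (f : A ⟶ B) {g h : B ⟶ D} (η : g ⟶ h) :
    Hom₂ (f ≫ g) (f ≫ h) where
  hom := f.hom ◁ η.hom
  comm := whiskerLeft_comm f η

/-- Right whiskering in the 2-category of coalgebras. -/
@[simps]
def whiskerR {A B D : Coalgebra T} {f g : A ⟶ B} (η : f ⟶ g) (h : B ⟶ D) :
    Hom₂ (f ≫ h) (g ≫ h) where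
  hom := η.hom ▷ h.hom
  comm := whiskerRight_comm η h

/-- The strict 2-category of coalgebras, coalgebra morphisms and their 2-cells. -/
instance : Bicategory (Coalgebra T) where
  homCategory A B := inferInstance
  whiskerLeft f _ _ η := whiskerL f η
  whiskerRight η h := whiskerR η h
  associator f g h := eqToIso (hom_ext (Strict.assoc (Hom.hom f) (Hom.hom g) (Hom.hom h)))
  leftUnitor f := eqToIso (hom_ext (Strict.id_comp (Hom.hom f)))
  rightUnitor f := eqToIso (hom_ext (Strict.comp_id (Hom.hom f)))
  whiskerLeft_id f g := by ext; simp
  whiskerLeft_comp f _ _ _ a b := by ext; simp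
  id_whiskerLeft a := by ext; simp [Strict.leftUnitor_eqToIso]
  comp_whiskerLeft f g _ _ a := by ext; simp [Strict.associator_eqToIso]
  id_whiskerRight f g := by ext; simp
  comp_whiskerRight a b f := by ext; simp
  whiskerRight_id a := by ext; simp [Strict.rightUnitor_eqToIso]
  whiskerRight_comp a f g := by ext; simp [Strict.associator_eqToIso]
  whisker_assoc f _ _ a g := by ext; simp [Strict.associator_eqToIso]
  whisker_exchange a b := by ext; exact whisker_exchange (Hom₂.hom a) (Hom₂.hom b)
  pentagon f g h i := by ext; simp
  triangle f g := by ext; simp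

instance : Bicategory.Strict (Coalgebra T) where
  id_comp f := hom_ext (Strict.id_comp (Hom.hom f))
  comp_id f := hom_ext (Strict.comp_id (Hom.hom f))
  assoc f g h := hom_ext (Strict.assoc (Hom.hom f) (Hom.hom g) (Hom.hom h))
  leftUnitor_eqToIso _ := rfl
  rightUnitor_eqToIso _ := rfl
  associator_eqToIso _ _ _ := rfl

end Coalgebra

end Coalg

/-- A 2-comonad is KZ if the structure 1-cell of each coalgebra is left adjoint to the counit, with
the identity 2-cell as unit of the adjunction. -/
def TwoComonad.IsKZ {C : Type u} [Bicategory.{w, v} C] [Bicategory.Strict C]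
    (T : TwoComonad C) : Prop :=
  ∀ A : Coalgebra T,
    ∃ a : Bicategory.Adjunction A.str (T.counit.app A.obj : T.fn.obj A.obj ⟶ A.obj),
      a.unit = eqToHom A.counit.symm

/-- The comparison 2-functor of a 2-adjunction `F ⊣ G` into the 2-category of coalgebras of the
induced 2-comonad; it sends `X` to the coalgebra `F η_X : F X ⟶ F G F X`. -/
def TwoAdjunction.comparison {B : Type u₁} [Bicategory.{w₁, v₁} B] [Bicategory.Strict B]
    {C : Type u₂} [Bicategory.{w₂, v₂} C] [Bicategory.Strict C]
    {F : StrictPseudofunctor B C} {G : StrictPseudofunctor C B} (adj : TwoAdjunction F G) :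
    StrictPseudofunctor B (Coalgebra adj.comonad) :=
  StrictPseudofunctor.mk''
    { obj := fun X =>
        { obj := F.obj X
          str := F.map (adj.unit.app X)
          counit := adj.left_triangle X
          coassoc := by
            have h := congrArg F.map (adj.unit.naturality (adj.unit.app X))
            exact (F.map_comp _ _).symm.trans (h.symm.trans (F.map_comp _ _)) }
      map := fun {X Y} f => Coalgebra.Hom.mk (F.map f) (by
        have h := congrArg F.map (adj.unit.naturality f)
        exact (F.map_comp _ _).symm.trans (h.symm.trans (F.map_comp _ _)))
      map₂ := fun {X Y f g} η => Coalgebra.Hom₂.mk (F.map₂ η) (by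
        exact square_symm _ _ (map₂_square F _ _ (adj.unit.naturality₂ η)))
      map₂_id := fun f => Coalgebra.hom₂_ext (F.map₂_id f)
      map₂_comp := fun η θ => Coalgebra.hom₂_ext (F.map₂_comp η θ)
      map_id := fun X => Coalgebra.hom_ext (F.map_id X)
      map_comp := fun f g => Coalgebra.hom_ext (F.map_comp f g)
      map₂_whisker_left := fun f _ _ η => Coalgebra.hom₂_ext (by
        simp only [Coalgebra.comp_hom₂, Coalgebra.eqToHom_hom]
        exact map₂_whiskerLeft' F f η)
      map₂_whisker_right := fun η f => Coalgebra.hom₂_ext (by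
        simp only [Coalgebra.comp_hom₂, Coalgebra.eqToHom_hom]
        exact map₂_whiskerRight' F η f) }

/-- A 2-functor is an isomorphism of 2-categories if it is bijective on objects, on 1-cells and on
2-cells. -/
structure IsTwoIso {B : Type u₁} [Bicategory.{w₁, v₁} B] {C : Type u₂} [Bicategory.{w₂, v₂} C]
    (F : StrictPseudofunctor B C) : Prop where
  obj : Function.Bijective F.obj
  map (X Y : B) : Function.Bijective (fun f : X ⟶ Y => F.map f)
  map₂ {X Y : B} (f g : X ⟶ Y) : Function.Bijective (fun η : f ⟶ g => F.map₂ η)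

/-- Data for a 2-category whose objects are indexed by `B`, lying over the objects of `C` through
`obj`, with 1-cells those 1-cells of `C` that satisfy `P`, and all 2-cells of `C` between them. -/
structure OneCells (B : Type u₁) (C : Type u₂) [Bicategory.{w₂, v₂} C] where
  obj : B → C
  P (X Y : B) : (obj X ⟶ obj Y) → Prop
  id_mem (X : B) : P X X (𝟙 (obj X))
  comp_mem {X Y Z : B} (f : obj X ⟶ obj Y) (g : obj Y ⟶ obj Z) : P X Y f → P Y Z g →
    P X Z (f ≫ g)

/-- The objects of the 2-category given by `W`. -/
structure LocallyFull {B : Type u₁} {C : Type u₂} [Bicategory.{w₂, v₂} C] (W : OneCells B C) where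
  as : B

namespace LocallyFull

variable {B : Type u₁} {C : Type u₂} [Bicategory.{w₂, v₂} C] {W : OneCells B C}

/-- The 1-cells. -/
@[ext]
structure Hom (X Y : LocallyFull W) where
  hom : W.obj X.as ⟶ W.obj Y.as
  mem : W.P X.as Y.as hom

/-- The 2-cells. -/
@[ext]
structure Hom₂ {X Y : LocallyFull W} (f g : Hom X Y) where
  hom : f.hom ⟶ g.hom

instance : CategoryStruct (LocallyFull W) where
  Hom X Y := Hom X Y
  id X := ⟨𝟙 (W.obj X.as), W.id_mem X.as⟩
  comp f g := ⟨f.hom ≫ g.hom, W.comp_mem f.hom g.hom f.mem g.mem⟩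

instance (X Y : LocallyFull W) : Category (X ⟶ Y) where
  Hom f g := Hom₂ f g
  id f := ⟨𝟙 f.hom⟩
  comp a b := ⟨a.hom ≫ b.hom⟩

@[simp]
theorem id_hom (X : LocallyFull W) : Hom.hom (𝟙 X) = 𝟙 (W.obj X.as) := rfl

@[simp]
theorem comp_hom {X Y Z : LocallyFull W} (f : X ⟶ Y) (g : Y ⟶ Z) :
    Hom.hom (f ≫ g) = f.hom ≫ g.hom := rfl

@[simp]
theorem id_hom₂ {X Y : LocallyFull W} (f : X ⟶ Y) : Hom₂.hom (𝟙 f) = 𝟙 f.hom := rfl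

@[simp]
theorem comp_hom₂ {X Y : LocallyFull W} {f g h : X ⟶ Y} (a : f ⟶ g) (b : g ⟶ h) :
    Hom₂.hom (a ≫ b) = a.hom ≫ b.hom := rfl

@[ext]
theorem hom_ext {X Y : LocallyFull W} {f g : X ⟶ Y} (h : f.hom = g.hom) : f = g := Hom.ext h

@[ext]
theorem hom₂_ext {X Y : LocallyFull W} {f g : X ⟶ Y} {a b : f ⟶ g} (h : a.hom = b.hom) : a = b :=
  Hom₂.ext h

@[simp]
theorem eqToHom_hom {X Y : LocallyFull W} {f g : X ⟶ Y} (h : f = g) :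
    (eqToHom h).hom = eqToHom (congrArg Hom.hom h) := by
  subst h; rfl

/-- Invertible 2-cells of the ambient 2-category are invertible here. -/
@[simps]
def isoMk {X Y : LocallyFull W} {f g : X ⟶ Y} (e : f.hom ≅ g.hom) : f ≅ g where
  hom := Hom₂.mk e.hom
  inv := Hom₂.mk e.inv
  hom_inv_id := hom₂_ext e.hom_inv_id
  inv_hom_id := hom₂_ext e.inv_hom_id

instance : Bicategory (LocallyFull W) where
  homCategory X Y := inferInstance
  whiskerLeft f _ _ η := Hom₂.mk (Hom.hom f ◁ Hom₂.hom η)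
  whiskerRight η h := Hom₂.mk (Hom₂.hom η ▷ Hom.hom h)
  associator f g h := isoMk (α_ (Hom.hom f) (Hom.hom g) (Hom.hom h))
  leftUnitor f := isoMk (λ_ (Hom.hom f))
  rightUnitor f := isoMk (ρ_ (Hom.hom f))
  whiskerLeft_id f g := by ext; simp
  whiskerLeft_comp f _ _ _ a b := by ext; simp
  id_whiskerLeft a := by ext; simp
  comp_whiskerLeft f g _ _ a := by ext; simp
  id_whiskerRight f g := by ext; simp
  comp_whiskerRight a b f := by ext; simp
  whiskerRight_id a := by ext; simp
  whiskerRight_comp a f g := by ext; simp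
  whisker_assoc f _ _ a g := by ext; simp
  whisker_exchange a b := by ext; exact whisker_exchange (Hom₂.hom a) (Hom₂.hom b)
  pentagon f g h i := by ext; simp
  triangle f g := by ext; simp

instance [Bicategory.Strict C] : Bicategory.Strict (LocallyFull W) where
  id_comp f := hom_ext (Strict.id_comp (Hom.hom f))
  comp_id f := hom_ext (Strict.comp_id (Hom.hom f))
  assoc f g h := hom_ext (Strict.assoc (Hom.hom f) (Hom.hom g) (Hom.hom h))
  leftUnitor_eqToIso f := by
    ext
    rw [eqToIso.hom, eqToHom_hom]
    exact congrArg Iso.hom (Strict.leftUnitor_eqToIso (Hom.hom f))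
  rightUnitor_eqToIso f := by
    ext
    rw [eqToIso.hom, eqToHom_hom]
    exact congrArg Iso.hom (Strict.rightUnitor_eqToIso (Hom.hom f))
  associator_eqToIso f g h := by
    ext
    rw [eqToIso.hom, eqToHom_hom]
    exact congrArg Iso.hom (Strict.associator_eqToIso (Hom.hom f) (Hom.hom g) (Hom.hom h))

end LocallyFull

end TwoCat

namespace Doctrines

open CategoryTheory Bicategory MonoidalCategory CartesianMonoidalCategory Opposite TwoCat
open Limits (PreservesFiniteProducts)

/-- A doctrine: a category with (chosen) finite products and a functor from its opposite to
posets. -/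
structure Doctrine where
  base : Type u
  [cat : Category.{v} base]
  [cart : CartesianMonoidalCategory base]
  fib : baseᵒᵖ ⥤ PartOrd.{w}

attribute [instance] Doctrine.cat Doctrine.cart

namespace Doctrine

/-- The fibre over an object. -/
abbrev Fib (P : Doctrine.{w, v, u}) (X : P.base) : Type w := P.fib.obj (op X)

/-- Reindexing along an arrow of the base. -/
def re (P : Doctrine.{w, v, u}) {X Y : P.base} (f : X ⟶ Y) (α : P.Fib Y) : P.Fib X :=
  P.fib.map f.op α

theorem re_mono (P : Doctrine.{w, v, u}) {X Y : P.base} (f : X ⟶ Y) {α β : P.Fib Y} (h : α ≤ β) :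
    P.re f α ≤ P.re f β :=
  (P.fib.map f.op).hom.monotone h

theorem re_id (P : Doctrine.{w, v, u}) {X : P.base} (α : P.Fib X) : P.re (𝟙 X) α = α := by
  simp [re]

theorem re_re (P : Doctrine.{w, v, u}) {X Y Z : P.base} (f : X ⟶ Y) (g : Y ⟶ Z) (α : P.Fib Z) :
    P.re f (P.re g α) = P.re (f ≫ g) α := by
  simp [re]

/-- A 1-arrow of doctrines: a finite product preserving functor between the bases and a natural
family of monotone maps between the fibres. -/
@[ext]
structure Hom (P Q : Doctrine.{w, v, u}) where
  fn : P.base ⥤ Q.base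
  pres : PreservesFiniteProducts fn
  nt : P.fib ⟶ fn.op ⋙ Q.fib

attribute [instance] Hom.pres

/-- The action of a 1-arrow on the fibre over `X`. -/
def Hom.on {P Q : Doctrine.{w, v, u}} (F : Hom P Q) {X : P.base} (α : P.Fib X) :
    Q.Fib (F.fn.obj X) :=
  F.nt.app (op X) α

/-- A 2-arrow `F ⟶ G` of doctrines: a natural transformation `θ` between the functors on the bases
such that `F_X ≤ Q(θ_X) ∘ G_X` for each object `X`. -/
@[ext]
structure Hom₂ {P Q : Doctrine.{w, v, u}} (F G : Hom P Q) where
  nat : F.fn ⟶ G.fn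
  le (X : P.base) (α : P.Fib X) : F.on α ≤ Q.re (nat.app X) (G.on α)

instance : CategoryStruct Doctrine.{w, v, u} where
  Hom P Q := Hom P Q
  id P := ⟨𝟭 P.base, inferInstance, 𝟙 P.fib⟩
  comp F G := ⟨F.fn ⋙ G.fn, inferInstance, F.nt ≫ F.fn.op.whiskerLeft G.nt⟩

instance (P Q : Doctrine.{w, v, u}) : Category (P ⟶ Q) where
  Hom F G := Hom₂ F G
  id F := ⟨𝟙 F.fn, fun X α => by simp [re_id]⟩
  comp {F G H} a b := ⟨a.nat ≫ b.nat, fun X α => by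
    rw [NatTrans.comp_app, ← re_re]
    exact (a.le X α).trans (Q.re_mono _ (b.le X α))⟩

@[simp]
theorem id_nat {P Q : Doctrine.{w, v, u}} (F : P ⟶ Q) : Hom₂.nat (𝟙 F) = 𝟙 F.fn := rfl

@[simp]
theorem comp_nat {P Q : Doctrine.{w, v, u}} {F G H : P ⟶ Q} (a : F ⟶ G) (b : G ⟶ H) :
    Hom₂.nat (a ≫ b) = a.nat ≫ b.nat := rfl

@[simp]
theorem id_fn (P : Doctrine.{w, v, u}) : Hom.fn (𝟙 P) = 𝟭 P.base := rfl

@[simp]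
theorem comp_fn {P Q S : Doctrine.{w, v, u}} (F : P ⟶ Q) (G : Q ⟶ S) :
    Hom.fn (F ≫ G) = F.fn ⋙ G.fn := rfl

@[simp]
theorem comp_on {P Q S : Doctrine.{w, v, u}} (F : P ⟶ Q) (G : Q ⟶ S) {X : P.base} (α : P.Fib X) :
    Hom.on (F ≫ G) α = G.on (F.on α) := rfl

@[simp]
theorem id_on (P : Doctrine.{w, v, u}) {X : P.base} (α : P.Fib X) : Hom.on (𝟙 P) α = α := rfl

theorem Hom.on_mono {P Q : Doctrine.{w, v, u}} (F : Hom P Q) {X : P.base} {α β : P.Fib X}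
    (h : α ≤ β) : F.on α ≤ F.on β :=
  (F.nt.app (op X)).hom.monotone h

theorem Hom.on_re {P Q : Doctrine.{w, v, u}} (F : Hom P Q) {X Y : P.base} (f : X ⟶ Y)
    (α : P.Fib Y) : F.on (P.re f α) = Q.re (F.fn.map f) (F.on α) :=
  ConcreteCategory.congr_hom (F.nt.naturality f.op) α

@[ext]
theorem hom₂_ext {P Q : Doctrine.{w, v, u}} {F G : P ⟶ Q} {a b : F ⟶ G} (h : a.nat = b.nat) :
    a = b := Hom₂.ext h

/-- Left whiskering. -/
@[simps]
def whiskerL {P Q S : Doctrine.{w, v, u}} (F : P ⟶ Q) {G H : Q ⟶ S} (a : G ⟶ H) :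
    Hom₂ (F ≫ G) (F ≫ H) where
  nat := F.fn.whiskerLeft a.nat
  le X α := Hom₂.le a (F.fn.obj X) (F.on α)

/-- Right whiskering. -/
@[simps]
def whiskerR {P Q S : Doctrine.{w, v, u}} {F G : P ⟶ Q} (a : F ⟶ G) (H : Q ⟶ S) :
    Hom₂ (F ≫ H) (G ≫ H) where
  nat := Functor.whiskerRight a.nat H.fn
  le X α := by
    have h := H.on_mono (Hom₂.le a X α)
    rw [H.on_re] at h
    exact h

/-- The invertible 2-arrow with identity components between equal 1-arrows. -/
def idIso {P Q : Doctrine.{w, v, u}} {F G : P ⟶ Q} (h : F = G) : F ≅ G where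
  hom := Hom₂.mk (eqToHom (congrArg Hom.fn h)) (fun X α => by subst h; simp [re_id])
  inv := Hom₂.mk (eqToHom (congrArg Hom.fn h.symm)) (fun X α => by subst h; simp [re_id])
  hom_inv_id := by ext; simp
  inv_hom_id := by ext; simp

/-- The 2-category of doctrines. -/
instance : Bicategory Doctrine.{w, v, u} where
  homCategory P Q := inferInstance
  whiskerLeft F _ _ a := whiskerL F a
  whiskerRight a H := whiskerR a H
  associator F G H := idIso (F := (F ≫ G) ≫ H) (G := F ≫ G ≫ H) rfl
  leftUnitor {P Q} F := idIso (F := 𝟙 P ≫ F) (G := F) rfl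
  rightUnitor {P Q} F := idIso (F := F ≫ 𝟙 Q) (G := F) rfl
  whiskerLeft_id F G := by ext; simp
  whiskerLeft_comp F _ _ _ a b := by ext; simp
  id_whiskerLeft a := by
    ext X; exact ((Category.id_comp _).trans (Category.comp_id _)).symm
  comp_whiskerLeft F G _ _ a := by
    ext X; exact ((Category.id_comp _).trans (Category.comp_id _)).symm
  id_whiskerRight F G := by ext; simp
  comp_whiskerRight a b F := by ext; simp
  whiskerRight_id a := by
    ext X; exact ((Category.id_comp _).trans (Category.comp_id _)).symm
  whiskerRight_comp a F G := by
    ext X; exact ((Category.id_comp _).trans (Category.comp_id _)).symm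
  whisker_assoc F _ _ a G := by
    ext X; exact ((Category.id_comp _).trans (Category.comp_id _)).symm
  whisker_exchange a b := by ext; simp
  pentagon F G H I := by
    ext X
    exact (by simp : I.fn.map (𝟙 (H.fn.obj (G.fn.obj (F.fn.obj X)))) ≫ 𝟙 _ ≫ 𝟙 _ = 𝟙 _ ≫ 𝟙 _)
  triangle F G := by
    ext X
    exact (by simp : 𝟙 _ ≫ 𝟙 _ = G.fn.map (𝟙 (F.fn.obj X)))

instance : Bicategory.Strict Doctrine.{w, v, u} where
  id_comp _ := rfl
  comp_id _ := rfl
  assoc _ _ _ := rfl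
  leftUnitor_eqToIso _ := rfl
  rightUnitor_eqToIso _ := rfl
  associator_eqToIso _ _ _ := rfl

end Doctrine
/-- A resource semiring: a semiring with a partial order for which addition and multiplication are
monotone. -/
class ResourceSemiring (R : Type x) extends Semiring R, PartialOrder R where
  add_mono {a b c d : R} : a ≤ b → c ≤ d → a + c ≤ b + d
  mul_mono {a b c d : R} : a ≤ b → c ≤ d → a * c ≤ b * d

section Projections

variable {C : Type u} [Category.{v} C] [CartesianMonoidalCategory C]

/-- The diagonal. -/
def diag (A : C) : A ⟶ A ⊗ A := lift (𝟙 A) (𝟙 A)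

/-- The arrow `⟨π₂, π₁⟩`. -/
def swap (A B : C) : A ⊗ B ⟶ B ⊗ A := lift (snd A B) (fst A B)

/-- The arrow `⟨π₁, π₂⟩` out of a ternary product. -/
def p₁₂ (X A B : C) : X ⊗ (A ⊗ B) ⟶ X ⊗ A := lift (fst X (A ⊗ B)) (snd X (A ⊗ B) ≫ fst A B)

/-- The arrow `⟨π₁, π₃⟩` out of a ternary product. -/
def p₁₃ (X A B : C) : X ⊗ (A ⊗ B) ⟶ X ⊗ B := lift (fst X (A ⊗ B)) (snd X (A ⊗ B) ≫ snd A B)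

/-- The arrow `⟨π₂, π₃⟩` out of a ternary product. -/
def p₂₃ (X A B : C) : X ⊗ (A ⊗ B) ⟶ A ⊗ B := snd X (A ⊗ B)

/-- The arrow `⟨π₁, π₃⟩` out of `A × X × A × X`. -/
def q₁₃ (A X : C) : (A ⊗ X) ⊗ (A ⊗ X) ⟶ A ⊗ A :=
  lift (fst (A ⊗ X) (A ⊗ X) ≫ fst A X) (snd (A ⊗ X) (A ⊗ X) ≫ fst A X)

/-- The arrow `⟨π₂, π₄⟩` out of `A × X × A × X`. -/
def q₂₄ (A X : C) : (A ⊗ X) ⊗ (A ⊗ X) ⟶ X ⊗ X :=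
  lift (fst (A ⊗ X) (A ⊗ X) ≫ snd A X) (snd (A ⊗ X) (A ⊗ X) ≫ snd A X)

end Projections

/-- A primary linear doctrine: each fibre is an ordered commutative monoid `(⋆, κ)`, and these
operations are preserved by reindexing. -/
structure LinearDoctrine extends Doctrine.{w, v, u} where
  tens {X : base} : toDoctrine.Fib X → toDoctrine.Fib X → toDoctrine.Fib X
  one (X : base) : toDoctrine.Fib X
  tens_mono {X : base} {α α' β β' : toDoctrine.Fib X} :
    α ≤ α' → β ≤ β' → tens α β ≤ tens α' β'
  tens_assoc {X : base} (α β γ : toDoctrine.Fib X) : tens (tens α β) γ = tens α (tens β γ)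
  tens_comm {X : base} (α β : toDoctrine.Fib X) : tens α β = tens β α
  one_tens {X : base} (α : toDoctrine.Fib X) : tens (one X) α = α
  re_tens {X Y : base} (f : X ⟶ Y) (α β : toDoctrine.Fib Y) :
    toDoctrine.re f (tens α β) = tens (toDoctrine.re f α) (toDoctrine.re f β)
  re_one {X Y : base} (f : X ⟶ Y) : toDoctrine.re f (one Y) = one X

namespace LinearDoctrine

/-- `ρ` is a distance on `A`. -/
structure IsDistance (P : LinearDoctrine.{w, v, u}) {A : P.base} (ρ : P.Fib (A ⊗ A)) : Prop where
  refl : P.one A ≤ P.re (diag A) ρ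
  symm : ρ ≤ P.re (swap A A) ρ
  trans : P.tens (P.re (p₁₂ A A A) ρ) (P.re (p₂₃ A A A) ρ) ≤ P.re (p₁₃ A A A) ρ

/-- `δ` is an equality predicate on `A`: it is reflexive and substitutive. -/
structure IsEqPred (P : LinearDoctrine.{w, v, u}) {A : P.base} (δ : P.Fib (A ⊗ A)) : Prop where
  refl : P.one A ≤ P.re (diag A) δ
  subst (X : P.base) (α : P.Fib (X ⊗ A)) :
    P.tens (P.re (p₁₂ X A A) α) (P.re (p₂₃ X A A) δ) ≤ P.re (p₁₃ X A A) α

/-- A primary linear doctrine is elementary if each object has an equality predicate. -/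
def IsElementary (P : LinearDoctrine.{w, v, u}) : Prop :=
  ∀ A : P.base, ∃ δ : P.Fib (A ⊗ A), P.IsEqPred δ

namespace IsEqPred

variable {P : LinearDoctrine.{w, v, u}} {A : P.base} {δ : P.Fib (A ⊗ A)}

theorem subst_at (h : P.IsEqPred δ) {Z X : P.base} (k : Z ⟶ X) (f g : Z ⟶ A)
    (α : P.Fib (X ⊗ A)) :
    P.tens (P.re (lift k f) α) (P.re (lift f g) δ) ≤ P.re (lift k g) α := by
  have h' := P.re_mono (lift k (lift f g)) (h.subst X α)
  rw [P.re_tens, P.re_re, P.re_re, P.re_re] at h'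
  convert h' using 3 <;> simp [p₁₂, p₂₃, p₁₃, comp_lift]

theorem le_of_refl (h : P.IsEqPred δ) {α : P.Fib (A ⊗ A)} (hα : P.one A ≤ P.re (diag A) α) :
    δ ≤ α := by
  have h₁ := h.subst_at (fst A A) (fst A A) (snd A A) α
  have h₂ : P.one (A ⊗ A) ≤ P.re (lift (fst A A) (fst A A)) α := by
    have h₃ := P.re_mono (fst A A) hα
    rw [P.re_one, P.re_re] at h₃
    convert h₃ using 2
    simp [diag, comp_lift]
  rw [lift_fst_snd, P.re_id, P.re_id] at h₁
  have h₄ := (P.tens_mono h₂ (le_refl δ)).trans h₁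
  rwa [P.one_tens] at h₄

theorem unique (h : P.IsEqPred δ) {δ' : P.Fib (A ⊗ A)} (h' : P.IsEqPred δ') : δ = δ' :=
  le_antisymm (h.le_of_refl h'.refl) (h'.le_of_refl h.refl)

theorem isDistance (h : P.IsEqPred δ) : P.IsDistance δ where
  refl := h.refl
  symm := h.le_of_refl (by
    rw [P.re_re]
    convert h.refl using 2
    simp [diag, swap, comp_lift])
  trans := h.subst A δ

theorem affine (h : P.IsEqPred δ) : δ ≤ P.one (A ⊗ A) :=
  h.le_of_refl (by rw [P.re_one])

theorem tens_le_left {X : P.base} {α β : P.Fib X} (h : β ≤ P.one X) : P.tens α β ≤ α := by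
  have h' := P.tens_mono (le_refl α) h
  rwa [P.tens_comm α (P.one X), P.one_tens] at h'

theorem prod (h : P.IsEqPred δ) {X : P.base} {τ : P.Fib (X ⊗ X)} (hτ : P.IsEqPred τ)
    {ζ : P.Fib ((A ⊗ X) ⊗ (A ⊗ X))} (hζ : P.IsEqPred ζ) :
    ζ = P.tens (P.re (q₁₃ A X) δ) (P.re (q₂₄ A X) τ) := by
  apply le_antisymm
  · apply hζ.le_of_refl
    rw [P.re_tens, P.re_re, P.re_re]
    have h₁ := P.re_mono (fst A X) h.refl
    have h₂ := P.re_mono (snd A X) hτ.refl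
    rw [P.re_one, P.re_re] at h₁ h₂
    have h₃ := P.tens_mono h₁ h₂
    rw [P.one_tens] at h₃
    convert h₃ using 3 <;> simp [diag, q₁₃, q₂₄, comp_lift]
  · have h₁ := h.subst_at
      (lift (fst (A ⊗ X) (A ⊗ X)) (fst (A ⊗ X) (A ⊗ X) ≫ snd A X))
      (fst (A ⊗ X) (A ⊗ X) ≫ fst A X) (snd (A ⊗ X) (A ⊗ X) ≫ fst A X)
      (P.re (lift (fst _ A ≫ fst (A ⊗ X) X) (lift (snd _ A) (fst _ A ≫ snd (A ⊗ X) X))) ζ)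
    have h₂ := hτ.subst_at
      (lift (fst (A ⊗ X) (A ⊗ X)) (snd (A ⊗ X) (A ⊗ X) ≫ fst A X))
      (fst (A ⊗ X) (A ⊗ X) ≫ snd A X) (snd (A ⊗ X) (A ⊗ X) ≫ snd A X)
      (P.re (lift (fst _ X ≫ fst (A ⊗ X) A) (lift (fst _ X ≫ snd (A ⊗ X) A) (snd _ X))) ζ)
    rw [P.re_re, P.re_re] at h₁ h₂
    have e₁ : lift (lift (fst (A ⊗ X) (A ⊗ X)) (fst (A ⊗ X) (A ⊗ X) ≫ snd A X))
        (fst (A ⊗ X) (A ⊗ X) ≫ fst A X) ≫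
          lift (fst _ A ≫ fst (A ⊗ X) X) (lift (snd _ A) (fst _ A ≫ snd (A ⊗ X) X)) =
        fst (A ⊗ X) (A ⊗ X) ≫ diag (A ⊗ X) := by
      ext <;> simp [diag]
    have e₂ : lift (lift (fst (A ⊗ X) (A ⊗ X)) (snd (A ⊗ X) (A ⊗ X) ≫ fst A X))
        (fst (A ⊗ X) (A ⊗ X) ≫ snd A X) ≫
          lift (fst _ X ≫ fst (A ⊗ X) A) (lift (fst _ X ≫ snd (A ⊗ X) A) (snd _ X)) =
        lift (lift (fst (A ⊗ X) (A ⊗ X)) (fst (A ⊗ X) (A ⊗ X) ≫ snd A X))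
        (snd (A ⊗ X) (A ⊗ X) ≫ fst A X) ≫
          lift (fst _ A ≫ fst (A ⊗ X) X) (lift (snd _ A) (fst _ A ≫ snd (A ⊗ X) X)) := by
      ext <;> simp
    have e₃ : lift (lift (fst (A ⊗ X) (A ⊗ X)) (snd (A ⊗ X) (A ⊗ X) ≫ fst A X))
        (snd (A ⊗ X) (A ⊗ X) ≫ snd A X) ≫
          lift (fst _ X ≫ fst (A ⊗ X) A) (lift (fst _ X ≫ snd (A ⊗ X) A) (snd _ X)) =
        𝟙 _ := by
      ext <;> simp
    rw [e₂, e₃, P.re_id] at h₂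
    rw [e₁, ← P.re_re] at h₁
    have h₀ := P.re_mono (fst (A ⊗ X) (A ⊗ X)) hζ.refl
    rw [P.re_one] at h₀
    have h₃ := (P.tens_mono h₀ (le_refl (P.re (q₁₃ A X) δ))).trans h₁
    rw [P.one_tens] at h₃
    exact (P.tens_mono h₃ (le_refl (P.re (q₂₄ A X) τ))).trans h₂

theorem unit_eq {δ : P.Fib (𝟙_ P.base ⊗ 𝟙_ P.base)} (h : P.IsEqPred δ) :
    δ = P.one (𝟙_ P.base ⊗ 𝟙_ P.base) := by
  apply le_antisymm h.affine
  have h₁ := P.re_mono (fst (𝟙_ P.base) (𝟙_ P.base)) h.refl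
  rw [P.re_one, P.re_re] at h₁
  have e : fst (𝟙_ P.base) (𝟙_ P.base) ≫ diag (𝟙_ P.base) = 𝟙 _ := by
    ext
  rwa [e, P.re_id] at h₁

end IsEqPred

end LinearDoctrine

/-- An `R`-graded doctrine: a primary linear doctrine with an `R`-graded linear exponential
modality. -/
structure GradedDoctrine (R : Type x) [ResourceSemiring R] extends
    LinearDoctrine.{w, v, u} where
  mod (r : R) {X : base} : toDoctrine.Fib X → toDoctrine.Fib X
  mod_mono (r : R) {X : base} {α β : toDoctrine.Fib X} : α ≤ β → mod r α ≤ mod r β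
  re_mod (r : R) {X Y : base} (f : X ⟶ Y) (α : toDoctrine.Fib Y) :
    toDoctrine.re f (mod r α) = mod r (toDoctrine.re f α)
  one_le_mod (r : R) (X : base) : one X ≤ mod r (one X)
  mod_tens_le (r : R) {X : base} (α β : toDoctrine.Fib X) :
    tens (mod r α) (mod r β) ≤ mod r (tens α β)
  weakening {X : base} (α : toDoctrine.Fib X) : mod 0 α ≤ one X
  contraction (r s : R) {X : base} (α : toDoctrine.Fib X) :
    mod (r + s) α ≤ tens (mod r α) (mod s α)
  counit {X : base} (α : toDoctrine.Fib X) : mod 1 α ≤ α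
  comult (r s : R) {X : base} (α : toDoctrine.Fib X) : mod (r * s) α ≤ mod r (mod s α)
  contravariance {r s : R} {X : base} (α : toDoctrine.Fib X) : s ≤ r → mod r α ≤ mod s α

variable {R : Type x} [ResourceSemiring R]

/-- An element of a fibre of a graded doctrine is intuitionistic if it is below all its
modalities. -/
def GradedDoctrine.IsIntuitionistic (P : GradedDoctrine.{w, v, u} R) {X : P.base}
    (α : P.Fib X) : Prop :=
  ∀ r : R, α ≤ P.mod r α

/-- 1-arrows of graded doctrines: 1-arrows of doctrines preserving the monoid structure on the
fibres and the modalities. -/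
structure IsGradedHom (P Q : GradedDoctrine.{w, v, u} R)
    (F : P.toDoctrine ⟶ Q.toDoctrine) : Prop where
  tens {X : P.base} (α β : P.Fib X) : F.on (P.tens α β) = Q.tens (F.on α) (F.on β)
  one (X : P.base) : F.on (P.one X) = Q.one (F.fn.obj X)
  mod (r : R) {X : P.base} (α : P.Fib X) : F.on (P.mod r α) = Q.mod r (F.on α)

theorem IsGradedHom.id (P : GradedDoctrine.{w, v, u} R) : IsGradedHom P P (𝟙 P.toDoctrine) where
  tens _ _ := rfl
  one _ := rfl
  mod _ _ _ := rfl

theorem IsGradedHom.comp {P Q S : GradedDoctrine.{w, v, u} R} {F : P.toDoctrine ⟶ Q.toDoctrine}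
    {G : Q.toDoctrine ⟶ S.toDoctrine} (hF : IsGradedHom P Q F) (hG : IsGradedHom Q S G) :
    IsGradedHom P S (F ≫ G) where
  tens α β := by simp only [Doctrine.comp_on, hF.tens, hG.tens]
  one X := by simp only [Doctrine.comp_on, hF.one, hG.one]; rfl
  mod r X α := by simp only [Doctrine.comp_on, hF.mod, hG.mod]

/-- An `R`-Lipschitz doctrine. -/
structure LipschitzDoctrine (R : Type x) [ResourceSemiring R] extends
    GradedDoctrine.{w, v, u} R where
  dist (A : base) : toDoctrine.Fib (A ⊗ A)
  isDistance (A : base) : toLinearDoctrine.IsDistance (dist A)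
  subst (A X : base) (α : toDoctrine.Fib (X ⊗ A)) :
    ∃ r : R, tens (toDoctrine.re (p₁₂ X A A) α) (mod r (toDoctrine.re (p₂₃ X A A) (dist A))) ≤
      toDoctrine.re (p₁₃ X A A) α
  dist_prod (A X : base) : dist (A ⊗ X) =
    tens (toDoctrine.re (q₁₃ A X) (dist A)) (toDoctrine.re (q₂₄ A X) (dist X))
  dist_prod_le_left (A X : base) : dist (A ⊗ X) ≤ toDoctrine.re (q₁₃ A X) (dist A)
  dist_prod_le_right (A X : base) : dist (A ⊗ X) ≤ toDoctrine.re (q₂₄ A X) (dist X)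
  dist_unit : dist (𝟙_ base) = one (𝟙_ base ⊗ 𝟙_ base)

/-- 1-arrows of Lipschitz doctrines: 1-arrows of graded doctrines preserving the distances, up to
the canonical isomorphism `F (A × A) ≅ F A × F A`. -/
structure IsLipschitzHom (P Q : LipschitzDoctrine.{w, v, u} R)
    (F : P.toDoctrine ⟶ Q.toDoctrine) : Prop
    extends IsGradedHom P.toGradedDoctrine Q.toGradedDoctrine F where
  dist (A : P.base) :
    Q.re (prodComparison F.fn A A) (Q.dist (F.fn.obj A)) = F.on (P.dist A)

/-- An elementary `R`-graded doctrine. -/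
structure ElementaryDoctrine (R : Type x) [ResourceSemiring R] extends
    GradedDoctrine.{w, v, u} R where
  elementary : toLinearDoctrine.IsElementary

namespace ElementaryDoctrine

/-- The equality predicate on `A` (it is unique). -/
noncomputable def eqPred (P : ElementaryDoctrine.{w, v, u} R) (A : P.base) : P.Fib (A ⊗ A) :=
  (P.elementary A).choose

theorem isEqPred (P : ElementaryDoctrine.{w, v, u} R) (A : P.base) :
    P.IsEqPred (P.eqPred A) :=
  (P.elementary A).choose_spec

/-- The left adjoint to reindexing along `id_X × Δ_A`. -/
noncomputable def exDiag (P : ElementaryDoctrine.{w, v, u} R) (X A : P.base)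
    (α : P.Fib (X ⊗ A)) : P.Fib (X ⊗ (A ⊗ A)) :=
  P.tens (P.re (p₁₂ X A A) α) (P.re (p₂₃ X A A) (P.eqPred A))

theorem exDiag_gc (P : ElementaryDoctrine.{w, v, u} R) (X A : P.base) :
    GaloisConnection (P.exDiag X A) (P.re (X ◁ diag A)) := by
  intro α β
  constructor
  · intro h
    have h₁ := P.re_mono (X ◁ diag A) h
    rw [exDiag, P.re_tens, P.re_re, P.re_re] at h₁
    have h₂ := P.re_mono (snd X A) (P.isEqPred A).refl
    rw [P.re_one, P.re_re] at h₂
    have h₃ := P.tens_mono h₂ (le_refl α)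
    rw [P.one_tens, P.tens_comm] at h₃
    refine h₃.trans (le_trans (le_of_eq ?_) h₁)
    congr 1
    · rw [← P.re_id α, P.re_re]
      congr 1
      ext <;> simp [p₁₂, diag]
    · congr 1
      simp [p₂₃]
  · intro h
    have h₁ := P.re_mono (p₁₂ X A A) h
    have h₂ := (P.isEqPred A).subst_at (p₁₂ X A A) (snd X (A ⊗ A) ≫ fst A A)
      (snd X (A ⊗ A) ≫ snd A A) (P.re (α_ X A A).hom β)
    rw [P.re_re] at h₁ h₂
    refine le_trans (le_trans (P.tens_mono h₁ le_rfl) (le_of_eq ?_)) (h₂.trans (le_of_eq ?_))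
    · congr 1
      · congr 1
        ext <;> simp [p₁₂, diag]
      · congr 1
        ext <;> simp [p₂₃]
    · rw [P.re_re]
      conv_rhs => rw [← P.re_id β]
      congr 1
      ext <;> simp [p₁₂]

theorem eqPred_intuitionistic (P : ElementaryDoctrine.{w, v, u} R) (A : P.base) :
    P.IsIntuitionistic (P.eqPred A) := fun r =>
  (P.isEqPred A).le_of_refl (by
    rw [P.re_mod]
    exact (P.one_le_mod r A).trans (P.mod_mono r (P.isEqPred A).refl))

/-- An elementary graded doctrine is Lipschitz, with the equality predicates as distances. -/
noncomputable def toLipschitz (P : ElementaryDoctrine.{w, v, u} R) :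
    LipschitzDoctrine.{w, v, u} R where
  toGradedDoctrine := P.toGradedDoctrine
  dist := P.eqPred
  isDistance A := (P.isEqPred A).isDistance
  subst A X α := ⟨1, (P.tens_mono le_rfl (P.counit _)).trans ((P.isEqPred A).subst X α)⟩
  dist_prod A X := (P.isEqPred A).prod (P.isEqPred X) (P.isEqPred (A ⊗ X))
  dist_prod_le_left A X := by
    rw [(P.isEqPred A).prod (P.isEqPred X) (P.isEqPred (A ⊗ X))]
    apply LinearDoctrine.IsEqPred.tens_le_left
    rw [← P.re_one (q₂₄ A X)]
    exact P.re_mono _ (P.isEqPred X).affine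
  dist_prod_le_right A X := by
    rw [(P.isEqPred A).prod (P.isEqPred X) (P.isEqPred (A ⊗ X)), P.tens_comm]
    apply LinearDoctrine.IsEqPred.tens_le_left
    rw [← P.re_one (q₁₃ A X)]
    exact P.re_mono _ (P.isEqPred A).affine
  dist_unit := (P.isEqPred _).unit_eq

end ElementaryDoctrine

/-- 1-arrows of elementary graded doctrines: 1-arrows of graded doctrines that commute with the
left adjoints to the reindexings along `id_X × Δ_A`, up to the canonical isomorphisms
`F (X × A) ≅ F X × F A` and `F (X × A × A) ≅ F X × F A × F A`. -/
structure IsElementaryHom (P Q : ElementaryDoctrine.{w, v, u} R)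
    (F : P.toDoctrine ⟶ Q.toDoctrine) : Prop
    extends IsGradedHom P.toGradedDoctrine Q.toGradedDoctrine F where
  exDiag (X A : P.base) (α : P.Fib (X ⊗ A)) :
    Q.re (prodComparison F.fn X (A ⊗ A) ≫ (F.fn.obj X ◁ prodComparison F.fn A A))
        (Q.exDiag (F.fn.obj X) (F.fn.obj A) (Q.re (inv (prodComparison F.fn X A)) (F.on α))) =
      F.on (P.exDiag X A α)

section

variable {P Q S : ElementaryDoctrine.{w, v, u} R} {F : P.toDoctrine ⟶ Q.toDoctrine}

theorem IsElementaryHom.eqPred (h : IsElementaryHom P Q F) (A : P.base) :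
    Q.re (prodComparison F.fn A A) (Q.eqPred (F.fn.obj A)) = F.on (P.eqPred A) := by
  have h₁ := h.exDiag (𝟙_ _) A (P.one _)
  simp only [ElementaryDoctrine.exDiag] at h₁
  rw [h.one, Q.re_one, Q.re_one,
    P.re_one, Q.one_tens, P.one_tens, Q.re_re, F.on_re] at h₁
  have e : (prodComparison F.fn (𝟙_ P.base) (A ⊗ A) ≫
      F.fn.obj (𝟙_ P.base) ◁ prodComparison F.fn A A) ≫
        p₂₃ (F.fn.obj (𝟙_ P.base)) (F.fn.obj A) (F.fn.obj A) =
      F.fn.map (p₂₃ (𝟙_ P.base) A A) ≫ prodComparison F.fn A A := by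
    simp [p₂₃]
  rw [e, ← Q.re_re] at h₁
  have e' : lift (toUnit (A ⊗ A)) (𝟙 (A ⊗ A)) ≫ p₂₃ (𝟙_ P.base) A A = 𝟙 _ := by
    simp [p₂₃]
  have inj (β : Q.Fib (F.fn.obj (A ⊗ A))) :
      Q.re (F.fn.map (lift (toUnit (A ⊗ A)) (𝟙 (A ⊗ A))))
        (Q.re (F.fn.map (p₂₃ (𝟙_ P.base) A A)) β) = β := by
    rw [Q.re_re, ← F.fn.map_comp, e', F.fn.map_id, Q.re_id]
  rw [← inj (Q.re _ _), h₁, inj]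

theorem IsElementaryHom.of_eqPred (h : IsGradedHom P.toGradedDoctrine Q.toGradedDoctrine F)
    (hd : ∀ A : P.base,
      Q.re (prodComparison F.fn A A) (Q.eqPred (F.fn.obj A)) = F.on (P.eqPred A)) :
    IsElementaryHom P Q F where
  toIsGradedHom := h
  exDiag X A α := by
    simp only [ElementaryDoctrine.exDiag]
    rw [h.tens, Q.re_tens, Q.re_re, Q.re_re, Q.re_re, F.on_re, F.on_re, ← hd, Q.re_re]
    congr 1
    · congr 1
      rw [IsIso.comp_inv_eq]
      ext <;> simp [p₁₂, ← Functor.map_comp]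
    · congr 1
      simp [p₂₃]

theorem IsElementaryHom.isLipschitzHom (h : IsElementaryHom P Q F) :
    IsLipschitzHom P.toLipschitz Q.toLipschitz F where
  toIsGradedHom := h.toIsGradedHom
  dist A := h.eqPred A

theorem IsLipschitzHom.isElementaryHom (h : IsLipschitzHom P.toLipschitz Q.toLipschitz F) :
    IsElementaryHom P Q F :=
  IsElementaryHom.of_eqPred h.toIsGradedHom h.dist

end

theorem IsLipschitzHom.id (P : LipschitzDoctrine.{w, v, u} R) :
    IsLipschitzHom P P (𝟙 P.toDoctrine) where
  toIsGradedHom := IsGradedHom.id P.toGradedDoctrine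
  dist A := by
    have e : prodComparison (Doctrine.Hom.fn (𝟙 P.toDoctrine)) A A = 𝟙 (A ⊗ A) := by
      ext <;> simp
    rw [e]
    exact P.re_id _

theorem IsLipschitzHom.comp {P Q S : LipschitzDoctrine.{w, v, u} R}
    {F : P.toDoctrine ⟶ Q.toDoctrine} {G : Q.toDoctrine ⟶ S.toDoctrine}
    (hF : IsLipschitzHom P Q F) (hG : IsLipschitzHom Q S G) : IsLipschitzHom P S (F ≫ G) where
  toIsGradedHom := hF.toIsGradedHom.comp hG.toIsGradedHom
  dist A := by
    have e : prodComparison (Doctrine.Hom.fn (F ≫ G)) A A =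
        G.fn.map (prodComparison F.fn A A) ≫
          prodComparison G.fn (F.fn.obj A) (F.fn.obj A) :=
      prodComparison_comp ..
    rw [e, Doctrine.comp_on, ← hF.dist, G.on_re, ← hG.dist, ← S.re_re]
    rfl

/-- The 1-arrows between `R`-Lipschitz doctrines. -/
def lipCells (R : Type x) [ResourceSemiring R] :
    OneCells (LipschitzDoctrine.{w, v, u} R) Doctrine.{w, v, u} where
  obj P := P.toDoctrine
  P := IsLipschitzHom
  id_mem := IsLipschitzHom.id
  comp_mem _ _ hF hG := IsLipschitzHom.comp hF hG

/-- The 2-category of `R`-Lipschitz doctrines, the 1-arrows of doctrines that preserve the graded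
structure and the distances, and all 2-arrows of doctrines between them. -/
abbrev LipDoc (R : Type x) [ResourceSemiring R] := LocallyFull (lipCells.{w, v, u} R)

/-- The 1-arrows between elementary `R`-graded doctrines. -/
def elCells (R : Type x) [ResourceSemiring R] :
    OneCells (ElementaryDoctrine.{w, v, u} R) Doctrine.{w, v, u} where
  obj P := P.toDoctrine
  P := IsElementaryHom
  id_mem P := (IsLipschitzHom.id P.toLipschitz).isElementaryHom
  comp_mem _ _ hF hG := (IsLipschitzHom.comp (IsElementaryHom.isLipschitzHom hF)
    (IsElementaryHom.isLipschitzHom hG)).isElementaryHom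

/-- The 2-category of elementary `R`-graded doctrines, the 1-arrows of doctrines that preserve the
graded structure and the left adjoints giving equality, and all 2-arrows of doctrines between
them. -/
abbrev ElDoc (R : Type x) [ResourceSemiring R] := LocallyFull (elCells.{w, v, u} R)

/-- The inclusion 2-functor of elementary graded doctrines into Lipschitz doctrines. -/
noncomputable def elToLip (R : Type x) [ResourceSemiring R] :
    StrictPseudofunctor (ElDoc.{w, v, u} R) (LipDoc.{w, v, u} R) :=
  StrictPseudofunctor.mk''
    { obj := fun P => ⟨P.as.toLipschitz⟩
      map := fun {P Q} f => LocallyFull.Hom.mk (W := lipCells R) (X := ⟨P.as.toLipschitz⟩)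
        (Y := ⟨Q.as.toLipschitz⟩) (LocallyFull.Hom.hom (W := elCells R) f)
        (IsElementaryHom.isLipschitzHom (LocallyFull.Hom.mem (W := elCells R) f))
      map₂ := fun a => LocallyFull.Hom₂.mk (LocallyFull.Hom₂.hom (W := elCells R) a)
      map₂_id := fun _ => rfl
      map₂_comp := fun _ _ => rfl
      map_id := fun _ => rfl
      map_comp := fun _ _ => rfl
      map₂_whisker_left := fun _ _ _ _ => by
        symm
        exact (Category.id_comp _).trans (Category.comp_id _)
      map₂_whisker_right := fun _ _ => by
        symm
        exact (Category.id_comp _).trans (Category.comp_id _) }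

section Restriction

variable {C : Type u} [Category.{v} C] [CartesianMonoidalCategory C]

/-- A full subcategory that contains the chosen terminal object and is closed under the chosen
binary products inherits these finite products. -/
@[reducible]
def subCartesian (S : ObjectProperty C) (h₀ : S (𝟙_ C)) (h₂ : ∀ X Y, S X → S Y → S (X ⊗ Y)) :
    CartesianMonoidalCategory S.FullSubcategory where
  __ := MonoidalCategory.fullSubcategory S h₀ h₂
  isTerminalTensorUnit := .ofUniqueHom (fun X ↦ ObjectProperty.homMk (toUnit X.1))
    fun _ _ ↦ by ext; apply toUnit_unique
  fst X Y := ObjectProperty.homMk (fst X.1 Y.1)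
  snd X Y := ObjectProperty.homMk (snd X.1 Y.1)
  tensorProductIsBinaryProduct X Y :=
    Limits.BinaryFan.IsLimit.mk _ (fun f g ↦ ObjectProperty.homMk (lift f.hom g.hom))
      (by intros; ext; simp) (by intros; ext; simp)
      (by intro T f g m h₁ h₂; ext; apply hom_ext <;> simp [← h₁, ← h₂])
  fst_def X Y := by ext; exact fst_def X.1 Y.1
  snd_def X Y := by ext; exact snd_def X.1 Y.1

end Restriction

/-- The restriction of a graded doctrine to a full subcategory of its base that is closed under
finite products. -/
def GradedDoctrine.restrict (P : GradedDoctrine.{w, v, u} R) (S : ObjectProperty P.base)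
    (h₀ : S (𝟙_ P.base)) (h₂ : ∀ X Y, S X → S Y → S (X ⊗ Y)) : GradedDoctrine.{w, v, u} R where
  base := S.FullSubcategory
  cart := subCartesian S h₀ h₂
  fib := S.ι.op ⋙ P.fib
  tens {X} α β := P.tens (X := X.obj) α β
  one X := P.one X.obj
  tens_mono h h' := P.tens_mono h h'
  tens_assoc := P.tens_assoc
  tens_comm := P.tens_comm
  one_tens := P.one_tens
  re_tens f := P.re_tens f.hom
  re_one f := P.re_one f.hom
  mod r X α := P.mod r (X := X.obj) α
  mod_mono r _ _ _ h := P.mod_mono r h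
  re_mod r _ _ f := P.re_mod r f.hom
  one_le_mod r X := P.one_le_mod r X.obj
  mod_tens_le r _ := P.mod_tens_le r
  weakening := P.weakening
  contraction r s _ := P.contraction r s
  counit := P.counit
  comult r s _ := P.comult r s
  contravariance := P.contravariance

namespace LipschitzDoctrine

/-- The objects of the base whose distance is intuitionistic. -/
def intObj (P : LipschitzDoctrine.{w, v, u} R) : ObjectProperty P.base :=
  fun A => P.IsIntuitionistic (P.dist A)

theorem intObj_unit (P : LipschitzDoctrine.{w, v, u} R) : P.intObj (𝟙_ P.base) := fun r => by
  rw [P.dist_unit]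
  exact P.one_le_mod r _

theorem intObj_prod (P : LipschitzDoctrine.{w, v, u} R) (A B : P.base) (hA : P.intObj A)
    (hB : P.intObj B) : P.intObj (A ⊗ B) := fun r => by
  rw [P.dist_prod]
  refine le_trans (P.tens_mono ?_ ?_) (P.mod_tens_le r _ _)
  · rw [← P.re_mod]
    exact P.re_mono _ (hA r)
  · rw [← P.re_mod]
    exact P.re_mono _ (hB r)

/-- The restriction of a Lipschitz doctrine to the objects whose distance is intuitionistic, as a
graded doctrine. -/
def intGraded (P : LipschitzDoctrine.{w, v, u} R) : GradedDoctrine.{w, v, u} R :=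
  P.restrict P.intObj P.intObj_unit P.intObj_prod

theorem intGraded_isEqPred (P : LipschitzDoctrine.{w, v, u} R) (A : P.intGraded.base) :
    P.intGraded.IsEqPred (A := A) (P.dist A.obj) where
  refl := (P.isDistance A.obj).refl
  subst X α := by
    obtain ⟨r, hr⟩ := P.subst A.obj X.obj α
    refine le_trans (P.tens_mono le_rfl ?_) hr
    rw [← P.re_mod]
    exact P.re_mono _ (A.property r)

/-- The restriction of a Lipschitz doctrine to the objects whose distance is intuitionistic is an
elementary graded doctrine. -/
def intPart (P : LipschitzDoctrine.{w, v, u} R) : ElementaryDoctrine.{w, v, u} R where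
  toGradedDoctrine := P.intGraded
  elementary A := ⟨P.dist A.obj, P.intGraded_isEqPred A⟩

theorem intPart_eqPred (P : LipschitzDoctrine.{w, v, u} R) (A : P.intPart.base) :
    P.intPart.eqPred A = P.dist A.obj :=
  (P.intPart.isEqPred A).unique (P.intGraded_isEqPred A)

end LipschitzDoctrine

theorem preservesFiniteProducts_ι {C : Type u} [Category.{v} C] [CartesianMonoidalCategory C]
    (S : ObjectProperty C) (h₀ : S (𝟙_ C)) (h₂ : ∀ X Y, S X → S Y → S (X ⊗ Y)) :
    PreservesFiniteProducts S.ι := by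
  let := subCartesian S h₀ h₂
  have h₁ (A B : S.FullSubcategory) : IsIso (prodComparison S.ι A B) := by
    have e : prodComparison S.ι A B = 𝟙 (A.obj ⊗ B.obj) := by
      apply hom_ext
      · exact (prodComparison_fst S.ι A B).trans (Category.id_comp _).symm
      · exact (prodComparison_snd S.ι A B).trans (Category.id_comp _).symm
    rw [e]
    exact IsIso.id _
  have h₃ : IsIso (terminalComparison S.ι) := by
    have e : terminalComparison S.ι = 𝟙 (𝟙_ C) := toUnit_unique _ _
    rw [e]
    exact IsIso.id _
  have := preservesLimitsOfShape_discrete_walkingPair_of_isIso_prodComparison S.ι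
  have := preservesLimit_empty_of_isIso_terminalComparison S.ι
  have := Limits.preservesLimitsOfShape_pempty_of_preservesTerminal S.ι
  exact .of_preserves_binary_and_terminal _

theorem preservesFiniteProducts_lift {C : Type u} [Category.{v} C] [CartesianMonoidalCategory C]
    {D : Type u₁} [Category.{v₁} D] (S : ObjectProperty C) (T : ObjectProperty D) (h₀ : S (𝟙_ C))
    (h₂ : ∀ X Y, S X → S Y → S (X ⊗ Y)) (F : C ⥤ D) [PreservesFiniteProducts F]
    (h : ∀ A : S.FullSubcategory, T ((S.ι ⋙ F).obj A)) :
    PreservesFiniteProducts (T.lift (S.ι ⋙ F) h) := by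
  have h₁ : PreservesFiniteProducts S.ι := preservesFiniteProducts_ι S h₀ h₂
  have h₃ : PreservesFiniteProducts (T.lift (S.ι ⋙ F) h ⋙ T.ι) :=
    inferInstanceAs (PreservesFiniteProducts (S.ι ⋙ F))
  exact ⟨fun n => Limits.preservesLimitsOfShape_of_reflects_of_preserves _ T.ι⟩

/-- The inclusion of the restriction of a Lipschitz doctrine to the objects with intuitionistic
distance into the doctrine itself. -/
def LipschitzDoctrine.incl (P : LipschitzDoctrine.{w, v, u} R) :
    P.intPart.toDoctrine ⟶ P.toDoctrine :=
  Doctrine.Hom.mk P.intObj.ι (preservesFiniteProducts_ι _ P.intObj_unit P.intObj_prod)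
    (𝟙 (P.intObj.ι.op ⋙ P.fib))

theorem LipschitzDoctrine.incl_mem (P : LipschitzDoctrine.{w, v, u} R) :
    IsLipschitzHom P.intPart.toLipschitz P P.incl where
  tens _ _ := rfl
  one _ := rfl
  mod _ _ _ := rfl
  dist A := by
    have e : prodComparison P.incl.fn A A = 𝟙 (A.obj ⊗ A.obj) := by
      apply hom_ext
      · exact (prodComparison_fst P.incl.fn A A).trans (Category.id_comp _).symm
      · exact (prodComparison_snd P.incl.fn A A).trans (Category.id_comp _).symm
    have h : P.intPart.toLipschitz.dist A = P.dist A.obj := P.intPart_eqPred A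
    rw [h]
    exact (congrArg (fun k => P.re k (P.dist A.obj)) e).trans (P.re_id _)

section

variable {P Q : LipschitzDoctrine.{w, v, u} R} {F : P.toDoctrine ⟶ Q.toDoctrine}

theorem IsLipschitzHom.intObj (h : IsLipschitzHom P Q F) {A : P.base} (hA : P.intObj A) :
    Q.intObj (F.fn.obj A) := fun r => by
  have h₁ := F.on_mono (hA r)
  rw [h.mod, ← h.dist, ← Q.re_mod] at h₁
  have h₂ := Q.re_mono (inv (prodComparison F.fn A A)) h₁
  rwa [Q.re_re, Q.re_re, IsIso.inv_hom_id, Q.re_id, Q.re_id] at h₂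

/-- The restriction of a 1-arrow of Lipschitz doctrines to the objects with intuitionistic
distance. -/
def IsLipschitzHom.restrict (h : IsLipschitzHom P Q F) :
    P.intPart.toDoctrine ⟶ Q.intPart.toDoctrine :=
  Doctrine.Hom.mk (Q.intObj.lift (P.intObj.ι ⋙ F.fn) (fun A => h.intObj A.property))
    (preservesFiniteProducts_lift P.intObj Q.intObj P.intObj_unit P.intObj_prod F.fn
      (fun A => h.intObj A.property))
    { app := fun X => F.nt.app (op X.unop.obj)
      naturality := fun _ _ f => F.nt.naturality f.unop.hom.op }

theorem IsLipschitzHom.restrict_mem (h : IsLipschitzHom P Q F) :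
    IsElementaryHom P.intPart Q.intPart h.restrict :=
  IsElementaryHom.of_eqPred
    { tens := fun α β => h.tens α β
      one := fun X => h.one X.obj
      mod := fun r _ α => h.mod r α }
    (fun A => by
      rw [LipschitzDoctrine.intPart_eqPred, LipschitzDoctrine.intPart_eqPred]
      have e : (prodComparison h.restrict.fn A A).hom = prodComparison F.fn A.obj A.obj := by
        apply hom_ext
        · exact (congrArg InducedCategory.Hom.hom (prodComparison_fst h.restrict.fn A A)).trans
            (prodComparison_fst F.fn A.obj A.obj).symm
        · exact (congrArg InducedCategory.Hom.hom (prodComparison_snd h.restrict.fn A A)).trans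
            (prodComparison_snd F.fn A.obj A.obj).symm
      refine Eq.trans ?_ (h.dist A.obj)
      rw [← e]
      rfl)

end

/-- The 2-functor sending a Lipschitz doctrine to its restriction to the objects whose distance is
intuitionistic, and restricting 1-arrows and 2-arrows accordingly. -/
def lipToEl (R : Type x) [ResourceSemiring R] :
    StrictPseudofunctor (LipDoc.{w, v, u} R) (ElDoc.{w, v, u} R) :=
  StrictPseudofunctor.mk''
    { obj := fun P => ⟨P.as.intPart⟩
      map := fun {P Q} f => LocallyFull.Hom.mk (W := elCells R) (X := ⟨P.as.intPart⟩)
        (Y := ⟨Q.as.intPart⟩) (LocallyFull.Hom.mem (W := lipCells R) f).restrict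
        (LocallyFull.Hom.mem (W := lipCells R) f).restrict_mem
      map₂ := fun {P Q f g} a => LocallyFull.Hom₂.mk
        (Doctrine.Hom₂.mk
          { app := fun X => ObjectProperty.homMk
              ((Doctrine.Hom₂.nat (LocallyFull.Hom₂.hom (W := lipCells R) a)).app X.obj)
            naturality := fun X Y k => ObjectProperty.hom_ext _
              ((Doctrine.Hom₂.nat (LocallyFull.Hom₂.hom (W := lipCells R) a)).naturality k.hom) }
          (fun X α => Doctrine.Hom₂.le (LocallyFull.Hom₂.hom (W := lipCells R) a) X.obj α))
      map₂_id := fun _ => rfl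
      map₂_comp := fun _ _ => rfl
      map_id := fun _ => rfl
      map_comp := fun _ _ => rfl
      map₂_whisker_left := fun _ _ _ _ => by
        symm
        exact (Category.id_comp _).trans (Category.comp_id _)
      map₂_whisker_right := fun _ _ => by
        symm
        exact (Category.id_comp _).trans (Category.comp_id _) }

/-- The inclusion `LipschitzDoctrine.incl`, as a 1-arrow of Lipschitz doctrines. -/
noncomputable def inclusion {R : Type x} [ResourceSemiring R] (P : LipDoc.{w, v, u} R) :
    (elToLip R).obj ((lipToEl R).obj P) ⟶ P :=
  LocallyFull.Hom.mk (W := lipCells R) (X := ⟨P.as.intPart.toLipschitz⟩) P.as.incl P.as.incl_mem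

end Doctrines

/-! Two facts carry the theorem. First, the inclusion `inclusion Q` of the intuitionistic part of a
Lipschitz doctrine is monic on 1-arrows (`inclusion_mono`): it is a full inclusion on bases and the
identity on fibres, so a 1-arrow into the restriction is the same as a 1-arrow into `Q` together
with the property that its values on objects have intuitionistic distance. Second, a Lipschitz
doctrine is elementary exactly when all its distances are intuitionistic. An equality predicate is
the least reflexive relation, and its modalities are reflexive too, so it lies below them;
conversely, an intuitionistic distance satisfies substitution without a grade, because it already
lies below the modality that the Lipschitz condition asks for.

Hence restricting an elementary doctrine discards no objects. The unit of the 2-adjunction is the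
identity, viewed as landing in the restriction. The naturality equations for 1-cells and the
triangle identities then hold by definition.

Now let `c` be a coalgebra structure, so that `c` followed by the counit is the identity. Cancelling
the monic counit shows that the opposite composite is also an identity, so `c` is inverse, and in
particular left adjoint, to the counit; this is KZ (`TwoComonad.isKZ_of_mono`). Since `c` is a
section, each object of the base is a value of the inclusion, so its distance is intuitionistic and
the doctrine is elementary (`intObj_of_section`, `toElementary`). Monicity makes `c` unique, and
uniqueness of equality predicates makes the distances the expected ones, so coalgebras are precisely
elementary doctrines. On 1-cells, preserving distances amounts to commuting with the left adjoints
along diagonals; 2-cells are those of doctrines on both sides. The comparison is therefore bijective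
at every level (`elLipAdjunction_comparison_isTwoIso`). -/

namespace TwoCat

open CategoryTheory Bicategory

/-! ### 2-comonads with monic counit -/

/-- In a strict 2-category, mutually inverse 1-cells are adjoint, with identity 2-cells as unit and
counit. -/
def adjunctionOfInverse {C : Type u} [Bicategory.{w, v} C] [Bicategory.Strict C] {X Y : C}
    {f : X ⟶ Y} {g : Y ⟶ X} (h : f ≫ g = 𝟙 X) (h' : g ≫ f = 𝟙 Y) :
    Bicategory.Adjunction f g where
  unit := eqToHom h.symm
  counit := eqToHom h'
  left_triangle := by
    -- By strictness every 2-cell in the zigzag is an `eqToHom`, possibly whiskered, and such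
    -- composites collapse to a single one.
    simp [leftZigzag, bicategoricalComp, Strict.associator_eqToIso, Strict.leftUnitor_eqToIso,
      Strict.rightUnitor_eqToIso]
  right_triangle := by
    simp [rightZigzag, bicategoricalComp, Strict.associator_eqToIso, Strict.leftUnitor_eqToIso,
      Strict.rightUnitor_eqToIso]

/-- If the counit at the underlying object is monic, a coalgebra is determined by that object. -/
theorem Coalgebra.eq_of_obj_eq {C : Type u} [Bicategory.{w, v} C] [Bicategory.Strict C]
    {T : TwoComonad C}
    (hT : ∀ (X Y : C) (f g : X ⟶ T.fn.obj Y),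
      f ≫ (T.counit.app Y : T.fn.obj Y ⟶ Y) = g ≫ (T.counit.app Y : T.fn.obj Y ⟶ Y) → f = g)
    {A B : Coalgebra T} (h : A.obj = B.obj) : A = B := by
  obtain ⟨X, a, ha, ha'⟩ := A
  obtain ⟨Y, b, hb, hb'⟩ := B
  obtain rfl : X = Y := h
  -- Both structure maps are sections of the same monic counit; the remaining fields are
  -- propositions.
  obtain rfl : a = b := hT _ _ _ _ (ha.trans hb.symm)
  rfl

/-- A 2-comonad with monic counit components is KZ. -/
theorem TwoComonad.isKZ_of_mono {C : Type u} [Bicategory.{w, v} C] [Bicategory.Strict C]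
    {T : TwoComonad C}
    (hT : ∀ (X Y : C) (f g : X ⟶ T.fn.obj Y),
      f ≫ (T.counit.app Y : T.fn.obj Y ⟶ Y) = g ≫ (T.counit.app Y : T.fn.obj Y ⟶ Y) → f = g) :
    T.IsKZ := fun A =>
  -- With ε the counit and `c` the structure map, (ε ≫ c) ≫ ε = ε ≫ (c ≫ ε) = ε = 𝟙 ≫ ε, and ε
  -- cancels. The unit of the resulting adjunction is the required identity 2-cell by construction.
  ⟨adjunctionOfInverse A.counit (hT _ _ _ _ ((Strict.assoc _ _ _).trans
    ((congrArg (fun t => (T.counit.app A.obj : T.fn.obj A.obj ⟶ A.obj) ≫ t) A.counit).trans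
      ((Strict.comp_id _).trans (Strict.id_comp _).symm)))), rfl⟩

end TwoCat

namespace Doctrines

open CategoryTheory Bicategory MonoidalCategory CartesianMonoidalCategory Opposite TwoCat
open Limits (PreservesFiniteProducts)

variable {R : Type x} [ResourceSemiring R]

/-! ### Factoring through the intuitionistic part -/

/-- The inclusion `T.ι` is fully faithful, hence reflects limits, and composing the lift with it
gives back `F`. -/
theorem preservesFiniteProducts_objectPropertyLift {C : Type u} [Category.{v} C] {D : Type u₁}
    [Category.{v₁} D] (T : ObjectProperty D) (F : C ⥤ D) [PreservesFiniteProducts F]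
    (h : ∀ A, T (F.obj A)) : PreservesFiniteProducts (T.lift F h) := by
  have : PreservesFiniteProducts (T.lift F h ⋙ T.ι) :=
    inferInstanceAs (PreservesFiniteProducts F)
  exact ⟨fun n => Limits.preservesLimitsOfShape_of_reflects_of_preserves _ T.ι⟩

namespace LipschitzDoctrine

/-- A 1-arrow into a Lipschitz doctrine whose values on objects have intuitionistic distance factors
through the restriction to such objects. -/
def corestrict (Q : LipschitzDoctrine.{w, v, u} R) {P : Doctrine.{w, v, u}}
    (F : P ⟶ Q.toDoctrine) (h : ∀ A, Q.intObj (F.fn.obj A)) : P ⟶ Q.intPart.toDoctrine :=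
  Doctrine.Hom.mk (Q.intObj.lift F.fn h)
    (preservesFiniteProducts_objectPropertyLift Q.intObj F.fn h)
    { app := fun X => F.nt.app X
      naturality := fun _ _ f => F.nt.naturality f }

/-- Composing with the inclusion forgets only proofs of membership, so eta for structures recovers
the 1-arrow. This exhibits it as a function of its composite with the inclusion, which is what
monicity needs. -/
theorem eq_corestrict (Q : LipschitzDoctrine.{w, v, u} R) {P : Doctrine.{w, v, u}}
    (F : P ⟶ Q.intPart.toDoctrine) :
    F = Q.corestrict (F ≫ Q.incl) (fun A => (F.fn.obj A).property) := rfl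

theorem incl_mono (Q : LipschitzDoctrine.{w, v, u} R) {P : Doctrine.{w, v, u}}
    {F G : P ⟶ Q.intPart.toDoctrine} (h : F ≫ Q.incl = G ≫ Q.incl) : F = G := by
  rw [Q.eq_corestrict F, Q.eq_corestrict G]
  congr 1

/-- The grade `r` in Lipschitz substitution depends on the predicate, but an intuitionistic distance
lies below all its modalities, so it can replace any of them. -/
theorem isEqPred_dist (P : LipschitzDoctrine.{w, v, u} R) {A : P.base} (hA : P.intObj A) :
    P.IsEqPred (P.dist A) where
  refl := (P.isDistance A).refl
  subst X α := by
    obtain ⟨r, hr⟩ := P.subst A X α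
    refine le_trans (P.tens_mono le_rfl ?_) hr
    rw [← P.re_mod]
    exact P.re_mono _ (hA r)

/-- A Lipschitz doctrine all of whose distances are intuitionistic is elementary. -/
def toElementary (P : LipschitzDoctrine.{w, v, u} R) (h : ∀ A, P.intObj A) :
    ElementaryDoctrine.{w, v, u} R where
  toGradedDoctrine := P.toGradedDoctrine
  elementary A := ⟨P.dist A, P.isEqPred_dist (h A)⟩

/-- The equality predicates are obtained by choice, but uniqueness identifies them with the given
distances. This makes the comparison surjective on objects on the nose. -/
theorem toElementary_toLipschitz (P : LipschitzDoctrine.{w, v, u} R) (h : ∀ A, P.intObj A) :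
    (P.toElementary h).toLipschitz = P := by
  have e : (P.toElementary h).eqPred = P.dist := funext fun A =>
    ((P.toElementary h).isEqPred A).unique (P.isEqPred_dist (h A))
  obtain ⟨G, d, _⟩ := P
  simp only [ElementaryDoctrine.toLipschitz, LipschitzDoctrine.mk.injEq]
  exact ⟨rfl, heq_of_eq e⟩

/-- If the inclusion of the restriction of a Lipschitz doctrine to the objects with intuitionistic
distance has a section, then all distances are intuitionistic. -/
theorem intObj_of_section (P : LipschitzDoctrine.{w, v, u} R)
    {c : P.toDoctrine ⟶ P.intPart.toDoctrine} (h : c ≫ P.incl = 𝟙 P.toDoctrine) (A : P.base) :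
    P.intObj A := by
  -- The section identity is a strict equality of functors, so `A` is literally an object of the
  -- restriction.
  have e : (c.fn.obj A).obj = A := congrArg (fun F => (Doctrine.Hom.fn F).obj A) h
  rw [← e]
  exact (c.fn.obj A).property

end LipschitzDoctrine

/-! ### Elementary doctrines and the unit -/

namespace ElementaryDoctrine

/-- The graded doctrine is retained, and being elementary is a property of it rather than extra
data. -/
theorem toLipschitz_injective :
    Function.Injective (toLipschitz : ElementaryDoctrine.{w, v, u} R → _) := by
  rintro ⟨P, _⟩ ⟨Q, _⟩ h
  obtain rfl : P = Q := congrArg LipschitzDoctrine.toGradedDoctrine h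
  rfl

/-- An elementary doctrine maps to the restriction of itself to the objects with intuitionistic
equality predicate, that is, to all objects. -/
noncomputable def toIntPart (P : ElementaryDoctrine.{w, v, u} R) :
    P.toDoctrine ⟶ P.toLipschitz.intPart.toDoctrine :=
  P.toLipschitz.corestrict (𝟙 P.toDoctrine) P.eqPred_intuitionistic

theorem toIntPart_mem (P : ElementaryDoctrine.{w, v, u} R) :
    IsElementaryHom P P.toLipschitz.intPart P.toIntPart :=
  IsElementaryHom.of_eqPred
    { tens := fun _ _ => rfl
      one := fun _ => rfl
      mod := fun _ _ _ => rfl }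
    (fun A => by
      rw [LipschitzDoctrine.intPart_eqPred]
      -- The restriction inherits the chosen products of the ambient base, so the canonical
      -- comparison is trivial and both equality predicates can be compared directly.
      have e : (prodComparison P.toIntPart.fn A A).hom = 𝟙 (A ⊗ A) := by
        apply hom_ext
        · exact (congrArg InducedCategory.Hom.hom (prodComparison_fst P.toIntPart.fn A A)).trans
            (Category.id_comp _).symm
        · exact (congrArg InducedCategory.Hom.hom (prodComparison_snd P.toIntPart.fn A A)).trans
            (Category.id_comp _).symm
      refine Eq.trans ?_ (P.re_id (P.eqPred A))
      rw [← e]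
      rfl)

end ElementaryDoctrine

/-! ### The 2-adjunction and its comparison -/

theorem inclusion_mono {P Q : LipDoc.{w, v, u} R} {F G : P ⟶ (elToLip R).obj ((lipToEl R).obj Q)}
    (h : F ≫ inclusion Q = G ≫ inclusion Q) : F = G :=
  LocallyFull.hom_ext (Q.as.incl_mono (congrArg LocallyFull.Hom.hom h))

/-- The 2-adjunction between elementary and Lipschitz doctrines. -/
noncomputable def elLipAdjunction (R : Type x) [ResourceSemiring R] :
    TwoAdjunction (elToLip.{w, v, u} R) (lipToEl.{w, v, u} R) where
  unit :=
    { app := fun P => LocallyFull.Hom.mk (W := elCells R) (X := P)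
        (Y := ⟨P.as.toLipschitz.intPart⟩) P.as.toIntPart P.as.toIntPart_mem
      naturality := fun _ => rfl
      -- The naturality squares commute by definition, so the `eqToHom` terms are identities, and
      -- the two whiskerings have the same components.
      naturality₂ := fun _ => (Category.comp_id _).trans (Category.id_comp _).symm }
  counit :=
    { app := inclusion
      naturality := fun _ => rfl
      naturality₂ := fun _ => (Category.comp_id _).trans (Category.id_comp _).symm }
  left_triangle _ := rfl
  right_triangle _ := rfl

theorem elLipAdjunction_comparison_isTwoIso (R : Type x) [ResourceSemiring R] :
    IsTwoIso (elLipAdjunction.{w, v, u} R).comparison where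
  obj := by
    constructor
    · rintro ⟨P⟩ ⟨Q⟩ h
      exact congrArg LocallyFull.mk (ElementaryDoctrine.toLipschitz_injective
        (congrArg (fun A => LocallyFull.as (Coalgebra.obj A)) h))
    · intro A
      have h : ∀ X, A.obj.as.intObj X :=
        A.obj.as.intObj_of_section (congrArg LocallyFull.Hom.hom A.counit)
      refine ⟨⟨A.obj.as.toElementary h⟩, ?_⟩
      -- Monicity settles the structure map, leaving only the underlying Lipschitz doctrines to be
      -- compared.
      apply Coalgebra.eq_of_obj_eq (fun _ _ _ _ => inclusion_mono)
      exact congrArg LocallyFull.mk (A.obj.as.toElementary_toLipschitz h)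
  map X Y := by
    constructor
    · intro f g h
      exact LocallyFull.hom_ext
        (congrArg (fun k => LocallyFull.Hom.hom (Coalgebra.Hom.hom k)) h)
    · intro k
      -- Preserving distances between elementary doctrines already gives an elementary 1-arrow;
      -- compatibility with the structure maps is a proposition, so the two coalgebra morphisms
      -- agree.
      exact ⟨LocallyFull.Hom.mk (W := elCells R)
        (LocallyFull.Hom.hom (W := lipCells R) (Coalgebra.Hom.hom k))
        (IsLipschitzHom.isElementaryHom
          (LocallyFull.Hom.mem (W := lipCells R) (Coalgebra.Hom.hom k))), rfl⟩
  map₂ f g := by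
    constructor
    · intro a b h
      exact LocallyFull.hom₂_ext
        (congrArg (fun k => LocallyFull.Hom₂.hom (Coalgebra.Hom₂.hom k)) h)
    · intro k
      exact ⟨LocallyFull.Hom₂.mk (W := elCells R)
        (LocallyFull.Hom₂.hom (W := lipCells R) (Coalgebra.Hom₂.hom k)), rfl⟩

end Doctrines

theorem mainTheorem5 (R : Type x) [Doctrines.ResourceSemiring R] :
    ∃ adj : TwoCat.TwoAdjunction (Doctrines.elToLip.{w, v, u} R) (Doctrines.lipToEl.{w, v, u} R),
      (∀ P, adj.counit.app P = Doctrines.inclusion P) ∧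
      TwoCat.IsTwoIso adj.comparison ∧
      adj.comonad.IsKZ :=
  ⟨Doctrines.elLipAdjunction R, fun _ => rfl, Doctrines.elLipAdjunction_comparison_isTwoIso R,
    TwoCat.TwoComonad.isKZ_of_mono fun _ _ _ _ => Doctrines.inclusion_mono⟩
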